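/- **Setting.** A rigid body occupies $\mathcal B=\Omega_1\setminus\overline{\mathcal C}$, where $\Omega_1,\mathcal C\subset\mathbb R^3$ are bounded, simply connected domains, $\overline{\mathcal C}\subset\Omega_1$, and the cavity $\mathcal C$ is of class $C^2$. The body has an integrable mass density $\rho_{\mathcal B}\ge 0$ on $\mathcal B$ with positive total mass. The cavity is completely filled with a liquid of constant density $\rho>0$ and viscosity $\mu>0$. The frame is attached to the body, and its origin is the center of mass of the whole system. Let $$\mathbf I=\int_{\mathcal B}\rho_{\mathcal B}\,(|x|^2\mathbf 1-x\otimes x)+\rho\int_{\mathcal C}(|x|^2\mathbf 1-x\otimes x)$$ be the central inertia tensor of the system. Let $H(\mathcal C)$ be the space of $\mathbf u\in L^2(\mathcal C;\mathbb R^3)$ with $\operatorname{div}\mathbf u=0$ and $\mathbf u\cdot\mathbf n|_{\partial\mathcal C}=0$ (in the sense of distributions), and let $\mathcal D_0^{1,2}(\mathcal C)=H(\mathcal C)\cap W^{1,2}_0(\mathcal C)$. Write $(\cdot,\cdot)$ and $\|\cdot\|_2$ for the scalar product and the norm of $L^2(\mathcal C)$, and put $$\mathbf a=-\rho\,\mathbf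 I^{-1}\cdot\int_{\mathcal C}x\times\mathbf v,\qquad \mathcal E=\tfrac12\left(\rho\|\mathbf v\|_2^2-\mathbf a\cdot\mathbf I\cdot\mathbf a+\boldsymbol\omega_\infty\cdot\mathbf I\cdot\boldsymbol\omega_\infty\right).$$ A pair $(\mathbf v,\boldsymbol\omega_\infty)$, in which $\mathbf v$ is the velocity of the liquid relative to the body and $\mathbf I\cdot\boldsymbol\omega_\infty$ is the total angular momentum, is a *weak solution* if (i) $\mathbf v\in C_w([0,\infty);H(\mathcal C))\cap L^\infty(0,\infty;H(\mathcal C))\cap L^2(0,\infty;\mathcal D_0^{1,2}(\mathcal C))$; (ii) $\boldsymbol\omega_\infty\in C^1((0,\infty))\cap C([0,\infty))$, with values in $\mathbb R^3$; (iii) $\mathcal E(t)+\mu\int_s^t\|\nabla\mathbf v(\tau)\|_2^2\,d\tau\le\mathcal E(s)$ for $s=0$ and for almost all $s>0$, and for all $t\ge s$; (iv) for all $t>0$ and all $\boldsymbol\psi\in\mathcal D_0^{1,2}(\mathcal C)$, $$\begin{aligned}&\rho(\mathbf v(t),\boldsymbol\psi)+\rho(\boldsymbol\omega_\infty(t)+\mathbf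 a(t))\cdot\int_{\mathcal C}x\times\boldsymbol\psi\\&\quad+\int_0^t\{\rho(\mathbf v\cdot\nabla\mathbf v,\boldsymbol\psi)+2\rho((\boldsymbol\omega_\infty+\mathbf a)\times\mathbf v,\boldsymbol\psi)+\mu(\nabla\mathbf v,\nabla\boldsymbol\psi)\}\,d\tau\\&=\rho(\mathbf v(0),\boldsymbol\psi)+\rho(\boldsymbol\omega_\infty(0)+\mathbf a(0))\cdot\int_{\mathcal C}x\times\boldsymbol\psi,\end{aligned}$$ $$\mathbf I\cdot\boldsymbol\omega_\infty(t)=\mathbf I\cdot\boldsymbol\omega_\infty(0)-\int_0^t(\boldsymbol\omega_\infty+\mathbf a)\times(\mathbf I\cdot\boldsymbol\omega_\infty)\,d\tau.$$ **Proposition 1.** For every $\mu>0$ and every weak solution $(\mathbf v,\boldsymbol\omega_\infty)$, $$\lim_{t\to\infty}\|\mathbf v(t)\|_2=0.$$ Moreover, if all eigenvalues of $\mathbf I$ coincide, that is, $\mathbf I=\lambda\mathbf 1$ for some $\lambda>0$, then there are constants $c_1,c_2>0$, depending only on $\Omega_1,\mathcal C,\rho_{\mathcal B},\rho$ (not on $\mu$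 and not on the solution), such that for every $\mu>0$ and every weak solution $$\|\mathbf v(t)\|_2\le c_1\|\mathbf v(0)\|_2\,e^{-c_2\mu t}\quad\text{for all }t>0.$$ -/

import Mathlib

open MeasureTheory Filter Topology Set
open scoped ContDiff Matrix

noncomputable section

namespace SolidLiquid

/-- Euclidean three-dimensional space. -/
abbrev E3 : Type := EuclideanSpace ℝ (Fin 3)

/-- Second-order tensors, with the norm `(G_ij G_ij)^(1/2)`. -/
abbrev T3 : Type := EuclideanSpace ℝ (Fin 3 × Fin 3)

/-- The vector product of `ℝ³`. -/
def cross (a b : E3) : E3 := WithLp.toLp 2 (crossProduct a.ofLp b.ofLp)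

/-- The action `M · b` of a tensor on a vector. -/
def act (M : Matrix (Fin 3) (Fin 3) ℝ) (b : E3) : E3 := WithLp.toLp 2 (M *ᵥ b.ofLp)

/-- The gradient of a differentiable vector field, with entries `(i, j) ↦ ∂_j φ_i`. -/
def gradField (φ : E3 → E3) (x : E3) : T3 :=
  WithLp.toLp 2 fun p => fderiv ℝ φ x (EuclideanSpace.single p.2 1) p.1

/-- `v · ∇v`: the vector `v_j G_ij`, for `G = ∇v`. -/
def convect (u : E3) (G : T3) : E3 := WithLp.toLp 2 fun i => ∑ j, u j * G (i, j)

/-- The open set `Ω` has a boundary of class `C²`: near each of its boundary points, `Ω` is the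
negativity set of a `C²` function whose differential does not vanish at that point. -/
def IsC2Domain (Ω : Set E3) : Prop :=
  ∀ x ∈ frontier Ω, ∃ U : Set E3, IsOpen U ∧ x ∈ U ∧ ∃ φ : E3 → ℝ,
    ContDiffOn ℝ 2 φ U ∧ fderiv ℝ φ x ≠ 0 ∧ Ω ∩ U = {y ∈ U | φ y < 0}

/-- A bounded, simply connected domain of `ℝ³`. -/
structure IsBoundedSimplyConnectedDomain (Ω : Set E3) : Prop where
  isOpen : IsOpen Ω
  bounded : Bornology.IsBounded Ω
  simplyConnected : IsSimplyConnected Ω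

/-! ### Function spaces -/

/-- Square-summable vector fields on `A`. -/
abbrev L2V (A : Set E3) : Type := Lp E3 2 ((volume : Measure E3).restrict A)

/-- Square-summable second-order tensor fields on `A`. -/
abbrev L2T (A : Set E3) : Type := Lp T3 2 ((volume : Measure E3).restrict A)

/-- The space `H(A)`: `∫_A u · ∇φ = 0` for all smooth compactly supported `φ` on `ℝ³`. Those `φ`
supported in `A` express `div u = 0`, and the remaining ones express `u · n = 0` on `∂A`, both in
the sense of distributions. -/
def spaceH (A : Set E3) : Set (L2V A) :=
  {u | ∀ φ : E3 → ℝ, ContDiff ℝ ∞ φ → HasCompactSupport φ → ∫ x in A, fderiv ℝ φ x (u x) = 0}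

/-- The pairs `(φ, ∇φ)` with `φ` a smooth vector field whose support is a compact subset of `A`. -/
def testGraph (A : Set E3) : Set (L2V A × L2T A) :=
  {p | ∃ φ : E3 → E3, ContDiff ℝ ∞ φ ∧ HasCompactSupport φ ∧ tsupport φ ⊆ A ∧
    p.1 =ᵐ[(volume : Measure E3).restrict A] φ ∧
    p.2 =ᵐ[(volume : Measure E3).restrict A] gradField φ}

/-- `u ∈ W₀^{1,2}(A)`, the closure of the test fields in the `W^{1,2}` norm, with `∇u = G`. -/
def IsW0Grad (A : Set E3) (u : L2V A) (G : L2T A) : Prop :=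
  (u, G) ∈ closure (testGraph A)

/-- `u ∈ D₀^{1,2}(A) = H(A) ∩ W₀^{1,2}(A)`, with `∇u = G`. -/
def IsD0Grad (A : Set E3) (u : L2V A) (G : L2T A) : Prop :=
  u ∈ spaceH A ∧ IsW0Grad A u G

/-- `f ∈ C_w(J; X)`. -/
def WeaklyContinuousOn {X : Type*} [NormedAddCommGroup X] [NormedSpace ℝ X]
    (f : ℝ → X) (J : Set ℝ) : Prop :=
  ∀ ℓ : X →L[ℝ] ℝ, ContinuousOn (fun t => ℓ (f t)) J

/-! ### The coupled system -/

/-- A rigid body `outer \ closure cavity` with a cavity filled by a homogeneous liquid, in a frame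
attached to the body and with the origin at the center of mass of the whole system. -/
structure SolidLiquidSystem where
  /-- The domain enclosed by the outer surface of the body. -/
  outer : Set E3
  /-- The cavity, which is the region occupied by the liquid. -/
  cavity : Set E3
  /-- The mass density of the rigid body. -/
  bodyDensity : E3 → ℝ
  /-- The constant density of the liquid. -/
  ρ : ℝ
  outer_domain : IsBoundedSimplyConnectedDomain outer
  cavity_domain : IsBoundedSimplyConnectedDomain cavity
  closure_cavity_subset : closure cavity ⊆ outer
  cavity_C2 : IsC2Domain cavity
  bodyDensity_nonneg : ∀ x ∈ outer \ closure cavity, 0 ≤ bodyDensity x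
  bodyDensity_integrable : IntegrableOn bodyDensity (outer \ closure cavity)
  bodyMass_pos : 0 < ∫ x in outer \ closure cavity, bodyDensity x
  ρ_pos : 0 < ρ
  center_of_mass :
    (∫ x in outer \ closure cavity, bodyDensity x • x) + ρ • (∫ x in cavity, x) = 0

namespace SolidLiquidSystem

variable (S : SolidLiquidSystem)

/-- The region occupied by the rigid body. -/
def body : Set E3 := S.outer \ closure S.cavity

/-- The central inertia tensor `𝐈` of the whole system. -/
def inertia : Matrix (Fin 3) (Fin 3) ℝ := Matrix.of fun i j =>
  (∫ x in S.body, S.bodyDensity x * (‖x‖ ^ 2 * (if i = j then 1 else 0) - x i * x j)) +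
    S.ρ * ∫ x in S.cavity, (‖x‖ ^ 2 * (if i = j then 1 else 0) - x i * x j)

/-- `∫_𝒞 x × w`. -/
def moment (w : L2V S.cavity) : E3 := ∫ x in S.cavity, cross x (w x)

/-- `𝐚 = -ρ 𝐈⁻¹ · ∫_𝒞 x × w`. -/
def avec (w : L2V S.cavity) : E3 := -(S.ρ • act S.inertia⁻¹ (S.moment w))

/-- The total energy `ℰ = ½ (ρ‖w‖₂² - 𝐚·𝐈·𝐚 + b·𝐈·b)`. -/
def energy (w : L2V S.cavity) (b : E3) : ℝ :=
  (1 / 2) * (S.ρ * ‖w‖ ^ 2 - inner ℝ (S.avec w) (act S.inertia (S.avec w))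
    + inner ℝ b (act S.inertia b))

/-- The trilinear term `(w · ∇w, ψ)`, with `G = ∇w`. -/
def convTerm (w : L2V S.cavity) (G : L2T S.cavity) (ψ : L2V S.cavity) : ℝ :=
  ∫ x in S.cavity, inner ℝ (convect (w x) (G x)) (ψ x)

/-- The term `(b × w, ψ)`. -/
def corTerm (b : E3) (w ψ : L2V S.cavity) : ℝ :=
  ∫ x in S.cavity, inner ℝ (cross b (w x)) (ψ x)

/-- `(v, ωinf)` is a weak solution with viscosity `μ`, where `ωinf` stands for `ω_∞` and `G(t)` is the
gradient of `v(t)`. Only the values at times `t ≥ 0` matter. -/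
structure IsWeakSolutionWithGrad (μ : ℝ) (v : ℝ → L2V S.cavity) (ωinf : ℝ → E3)
    (G : ℝ → L2T S.cavity) : Prop where
  mem_H : ∀ t, 0 ≤ t → v t ∈ spaceH S.cavity
  weak_cont : WeaklyContinuousOn v (Ici 0)
  memLp_top : MemLp v ⊤ (volume.restrict (Ioi (0 : ℝ)))
  grad : ∀ᵐ t ∂(volume.restrict (Ioi (0 : ℝ))), IsD0Grad S.cavity (v t) (G t)
  memLp_two : MemLp v 2 (volume.restrict (Ioi (0 : ℝ)))
  memLp_two_grad : MemLp G 2 (volume.restrict (Ioi (0 : ℝ)))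
  omega_C1 : ContDiffOn ℝ 1 ωinf (Ioi 0)
  omega_cont : ContinuousOn ωinf (Ici 0)
  energy_zero : ∀ t, 0 ≤ t →
    S.energy (v t) (ωinf t) + μ * ∫ τ in (0 : ℝ)..t, ‖G τ‖ ^ 2 ≤ S.energy (v 0) (ωinf 0)
  energy_ae : ∀ᵐ s ∂(volume.restrict (Ioi (0 : ℝ))), ∀ t, s ≤ t →
    S.energy (v t) (ωinf t) + μ * ∫ τ in s..t, ‖G τ‖ ^ 2 ≤ S.energy (v s) (ωinf s)
  momentum : ∀ (ψ : L2V S.cavity) (Ψ : L2T S.cavity), IsD0Grad S.cavity ψ Ψ → ∀ t, 0 < t →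
    S.ρ * inner ℝ (v t) ψ + S.ρ * inner ℝ (ωinf t + S.avec (v t)) (S.moment ψ)
      + (∫ τ in (0 : ℝ)..t, (S.ρ * S.convTerm (v τ) (G τ) ψ
          + 2 * S.ρ * S.corTerm (ωinf τ + S.avec (v τ)) (v τ) ψ + μ * inner ℝ (G τ) Ψ))
      = S.ρ * inner ℝ (v 0) ψ + S.ρ * inner ℝ (ωinf 0 + S.avec (v 0)) (S.moment ψ)
  angular : ∀ t, 0 < t →
    act S.inertia (ωinf t) = act S.inertia (ωinf 0)
      - ∫ τ in (0 : ℝ)..t, cross (ωinf τ + S.avec (v τ)) (act S.inertia (ωinf τ))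

/-- `(v, ωinf)` is a weak solution (à la Leray–Hopf) with viscosity `μ`. The gradient of `v(t)` is
determined by `v(t)` for almost every `t`. -/
def IsWeakSolution (μ : ℝ) (v : ℝ → L2V S.cavity) (ωinf : ℝ → E3) : Prop :=
  ∃ G : ℝ → L2T S.cavity, S.IsWeakSolutionWithGrad μ v ωinf G

end SolidLiquidSystem

end SolidLiquid

end

/-!
The decay of `v` follows from the energy inequality, once the change of `ω_∞·𝐈·ω_∞` is estimated by
means of the balance of angular momentum.

*Coercivity.* Let `β` be the quadratic form of inertia of the rigid body. The relative kinetic energy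
`F(w) = ρ‖w‖² - 𝐚·𝐈·𝐚` equals `ρ‖w + 𝐚 × x‖² + β(𝐚)` (`relEnergy_eq`). Since lines are null sets and
the body has positive mass, `β` is positive definite (`inertia_pos`); therefore `𝐈` is invertible, and
`F` is equivalent to `‖·‖²` (`relEnergy_le`, `exists_norm_sq_le_relEnergy`).

*Angular momentum.* From `(𝐈·ω_∞)' = -(ω_∞ + 𝐚) × 𝐈·ω_∞` it follows that `|𝐈·ω_∞|` is constant, that
`ω_∞` is bounded, and that `(ω_∞·𝐈·ω_∞)' = -2 ω_∞·(𝐚 × 𝐈·ω_∞)`, which is bounded by a multiple of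
`‖v‖` (`rigidEnergy_le`) and vanishes if `𝐈` is isotropic (`rigidEnergy_eq_of_isotropic`).

*Convergence.* The energy inequality yields `F(v(t)) ≤ F(v(s)) + B ∫_s^t ‖v‖` for almost every `s`.
Averaging over `s ∈ (t - 1, t)` bounds `F(v(t))` by integrals over a window of length one that tend
to zero, because `v ∈ L²(0, ∞; L²)` (`tendsto_zero_of_ae_le`).

*Exponential decay.* If `𝐈` is isotropic, then `F(v(t)) + 2μ ∫_s^t ‖∇v‖² ≤ F(v(s))`. The Poincaré
inequality (`exists_poincare`), which is a case of the Gagliardo–Nirenberg–Sobolev inequality, bounds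
`F(v)` by a multiple of `‖∇v‖²`, and a Grönwall argument that needs only almost every initial time
(`le_exp_of_ae_le`) concludes.
-/

namespace SolidLiquid

/-! ### Vector algebra -/

lemma inner_eq_sum (a b : E3) : inner ℝ a b = a 0 * b 0 + a 1 * b 1 + a 2 * b 2 := by
  simp [PiLp.inner_apply, Fin.sum_univ_three, mul_comm]

lemma cross_zero_apply (a b : E3) : cross a b 0 = a 1 * b 2 - a 2 * b 1 := by
  simp [cross, cross_apply]

lemma cross_one_apply (a b : E3) : cross a b 1 = a 2 * b 0 - a 0 * b 2 := by
  simp [cross, cross_apply]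

lemma cross_two_apply (a b : E3) : cross a b 2 = a 0 * b 1 - a 1 * b 0 := by
  simp [cross, cross_apply]

lemma cross_add_left (a b c : E3) : cross (a + b) c = cross a c + cross b c := by
  simp [cross]

lemma cross_add_right (a b c : E3) : cross a (b + c) = cross a b + cross a c := by
  simp [cross]

lemma cross_smul_left (r : ℝ) (a b : E3) : cross (r • a) b = r • cross a b := by
  simp [cross]

lemma cross_smul_right (r : ℝ) (a b : E3) : cross a (r • b) = r • cross a b := by
  simp [cross]

lemma inner_cross_cyclic (a b c : E3) : inner ℝ (cross a b) c = inner ℝ a (cross b c) := by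
  simp only [inner_eq_sum, cross_zero_apply, cross_one_apply, cross_two_apply]
  ring

lemma inner_self_cross (a b : E3) : inner ℝ a (cross a b) = 0 := by
  simp only [inner_eq_sum, cross_zero_apply, cross_one_apply, cross_two_apply]
  ring

lemma inner_cross_self (a b : E3) : inner ℝ b (cross a b) = 0 := by
  simp only [inner_eq_sum, cross_zero_apply, cross_one_apply, cross_two_apply]
  ring

/-- Lagrange's identity. -/
lemma norm_cross_sq (a b : E3) :
    ‖cross a b‖ ^ 2 = ‖a‖ ^ 2 * ‖b‖ ^ 2 - inner ℝ a b ^ 2 := by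
  simp only [← real_inner_self_eq_norm_sq, inner_eq_sum, cross_zero_apply, cross_one_apply,
    cross_two_apply]
  ring

lemma norm_cross_le (a b : E3) : ‖cross a b‖ ≤ ‖a‖ * ‖b‖ := by
  refine abs_le_of_sq_le_sq' ?_ (by positivity) |>.2
  rw [norm_cross_sq, mul_pow]
  linarith [sq_nonneg (inner ℝ a b)]

/-- The vector product as a continuous bilinear map. -/
noncomputable def crossL : E3 →L[ℝ] E3 →L[ℝ] E3 :=
  (LinearMap.mk₂ ℝ cross cross_add_left cross_smul_left cross_add_right
    cross_smul_right).mkContinuous₂ 1 fun a b => by simpa using norm_cross_le a b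

lemma crossL_apply (a b : E3) : crossL a b = cross a b := rfl

/-- The action of a tensor as a continuous linear map. -/
noncomputable def actL (M : Matrix (Fin 3) (Fin 3) ℝ) : E3 →L[ℝ] E3 :=
  LinearMap.toContinuousLinearMap
    { toFun := act M
      map_add' := fun a b => by simp [act, Matrix.mulVec_add]
      map_smul' := fun r a => by simp [act, Matrix.mulVec_smul] }

lemma actL_apply (M : Matrix (Fin 3) (Fin 3) ℝ) (b : E3) : actL M b = act M b := rfl

lemma act_act (M N : Matrix (Fin 3) (Fin 3) ℝ) (b : E3) : act M (act N b) = act (M * N) b := by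
  simp [act, Matrix.mulVec_mulVec]

lemma act_one (b : E3) : act 1 b = b := by simp [act]

lemma act_add (M N : Matrix (Fin 3) (Fin 3) ℝ) (b : E3) :
    act (M + N) b = act M b + act N b := by
  simp [act, Matrix.add_mulVec]

lemma act_smul (r : ℝ) (M : Matrix (Fin 3) (Fin 3) ℝ) (b : E3) :
    act (r • M) b = r • act M b := by
  simp [act, Matrix.smul_mulVec]

lemma inner_act_comm {M : Matrix (Fin 3) (Fin 3) ℝ} (hM : M.IsSymm) (a b : E3) :
    inner ℝ a (act M b) = inner ℝ b (act M a) := by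
  have h := fun i j => hM.apply i j
  simp only [inner_eq_sum, act, Matrix.mulVec, dotProduct, Fin.sum_univ_three]
  rw [h 1 0, h 2 0, h 2 1]
  ring

lemma inner_act_self (M : Matrix (Fin 3) (Fin 3) ℝ) (a : E3) :
    inner ℝ a (act M a) = ∑ i, ∑ j, a i * a j * M i j := by
  simp only [inner_eq_sum, act, Matrix.mulVec, dotProduct, Fin.sum_univ_three]
  ring

/-! ### Quadratic forms of inertia -/

lemma norm_cross_sq_eq_sum (a x : E3) : ‖cross a x‖ ^ 2 =
    ∑ i, ∑ j, a i * a j * (‖x‖ ^ 2 * (if i = j then 1 else 0) - x i * x j) := by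
  rw [norm_cross_sq]
  simp only [← real_inner_self_eq_norm_sq, inner_eq_sum, Fin.sum_univ_three]
  simp
  ring

/-- A density that is integrable on a bounded set remains so after multiplication with a continuous
function. -/
lemma integrableOn_mul_continuous {A : Set E3} (hA : MeasurableSet A) (hb : Bornology.IsBounded A)
    {σ : E3 → ℝ} (hσ : IntegrableOn σ A) {g : E3 → ℝ} (hg : Continuous g) :
    IntegrableOn (fun x => σ x * g x) A := by
  obtain ⟨C, hC⟩ := (hb.isCompact_closure.image hg).isBounded.exists_norm_le
  refine Integrable.mul_bdd (c := C) hσ hg.aestronglyMeasurable ?_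
  filter_upwards [ae_restrict_mem hA] with x hx
  exact hC _ ⟨x, subset_closure hx, rfl⟩

/-- The tensor of inertia of the density `σ` on `A` has the quadratic form `∫_A σ |a × x|²`. -/
lemma inner_act_inertia {A : Set E3} (hA : MeasurableSet A) (hb : Bornology.IsBounded A)
    {σ : E3 → ℝ} (hσ : IntegrableOn σ A) (a : E3) :
    inner ℝ a (act (Matrix.of fun i j =>
      ∫ x in A, σ x * (‖x‖ ^ 2 * (if i = j then 1 else 0) - x i * x j)) a) =
      ∫ x in A, σ x * ‖cross a x‖ ^ 2 := by
  have hint : ∀ i j : Fin 3, IntegrableOn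
      (fun x : E3 => σ x * (‖x‖ ^ 2 * (if i = j then 1 else 0) - x i * x j)) A := fun i j =>
    integrableOn_mul_continuous hA hb hσ (by fun_prop)
  rw [inner_act_self]
  simp only [Matrix.of_apply, ← integral_const_mul]
  rw [integral_congr_ae (g := fun x => ∑ i, ∑ j, a i * a j *
    (σ x * (‖x‖ ^ 2 * (if i = j then 1 else 0) - x i * x j)))
    (Eventually.of_forall fun x => ?_)]
  · rw [integral_finsetSum _ fun i _ => integrable_finsetSum _ fun j _ =>
      (hint i j).integrable.const_mul _]
    refine Finset.sum_congr rfl fun i _ => ?_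
    rw [integral_finsetSum _ fun j _ => (hint i j).integrable.const_mul _]
  · simp only [norm_cross_sq_eq_sum, Finset.mul_sum]
    exact Finset.sum_congr rfl fun i _ => Finset.sum_congr rfl fun j _ => by ring

lemma volume_line (a : E3) : volume ({x : E3 | ∃ r : ℝ, x = r • a}) = 0 := by
  have h : {x : E3 | ∃ r : ℝ, x = r • a} = (Submodule.span ℝ {a} : Set E3) := by
    ext x
    simp [Submodule.mem_span_singleton, eq_comm]
  rw [h]
  refine Measure.addHaar_submodule _ _ fun htop => ?_
  have h1 := finrank_span_le_card (R := ℝ) ({a} : Set E3)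
  rw [htop, finrank_top, finrank_euclideanSpace_fin] at h1
  simp at h1

lemma ae_cross_ne_zero {a : E3} (ha : a ≠ 0) : ∀ᵐ x : E3, cross a x ≠ 0 := by
  refine measure_mono_null (fun x hx => ?_) (volume_line a)
  have hx : cross a x = 0 := by simpa using hx
  have h0 : 0 < ‖a‖ ^ 2 := by positivity
  refine ⟨inner ℝ a x / ‖a‖ ^ 2, sub_eq_zero.1 (norm_eq_zero.1 ?_)⟩
  have h := norm_cross_sq a x
  rw [hx, norm_zero] at h
  rw [← sq_eq_zero_iff, norm_sub_sq_real, inner_smul_right, norm_smul, mul_pow, Real.norm_eq_abs,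
    sq_abs, real_inner_comm]
  field_simp
  rw [real_inner_comm]
  linarith

/-- A mass that is spread over a set of positive measure has a positive moment of inertia about
every axis. -/
lemma inertia_pos {A : Set E3} (hA : MeasurableSet A) (hb : Bornology.IsBounded A)
    {σ : E3 → ℝ} (hσ : IntegrableOn σ A) (h0 : ∀ x ∈ A, 0 ≤ σ x) (hm : 0 < ∫ x in A, σ x)
    {a : E3} (ha : a ≠ 0) : 0 < ∫ x in A, σ x * ‖cross a x‖ ^ 2 := by
  have hnn : 0 ≤ᵐ[volume.restrict A] fun x => σ x * ‖cross a x‖ ^ 2 := by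
    filter_upwards [ae_restrict_mem hA] with x hx
    have := h0 x hx
    positivity
  refine (integral_nonneg_of_ae hnn).lt_of_ne fun h => hm.ne' ?_
  have hc : Continuous fun x : E3 => ‖cross a x‖ ^ 2 := by
    simp only [← crossL_apply]; fun_prop
  have h1 := (integral_eq_zero_iff_of_nonneg_ae hnn
    (integrableOn_mul_continuous hA hb hσ hc)).1 h.symm
  refine integral_eq_zero_of_ae ?_
  filter_upwards [h1, ae_restrict_of_ae (ae_cross_ne_zero ha)] with x hx hx'
  simpa [hx'] using hx

/-- A continuous, quadratically homogeneous function that is positive off the origin is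
coercive. -/
lemma exists_coercive {q : E3 → ℝ} (hc : Continuous q) (hh : ∀ (r : ℝ) a, q (r • a) = r ^ 2 * q a)
    (hp : ∀ a, a ≠ 0 → 0 < q a) : ∃ δ, 0 < δ ∧ ∀ a, δ * ‖a‖ ^ 2 ≤ q a := by
  have hne : (Metric.sphere (0 : E3) 1).Nonempty := NormedSpace.sphere_nonempty.2 zero_le_one
  obtain ⟨e, he, hmin⟩ := (isCompact_sphere (0 : E3) 1).exists_isMinOn hne hc.continuousOn
  have he1 : ‖e‖ = 1 := by simpa using he
  refine ⟨q e, hp e (norm_ne_zero_iff.1 (by simp [he1])), fun a => ?_⟩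
  rcases eq_or_ne a 0 with rfl | ha
  · simpa using (hh 0 0).ge
  have ha' : ‖a‖ ≠ 0 := norm_ne_zero_iff.2 ha
  have h1 : q e ≤ q (‖a‖⁻¹ • a) := hmin (by simp [norm_smul, ha'])
  calc q e * ‖a‖ ^ 2 ≤ q (‖a‖⁻¹ • a) * ‖a‖ ^ 2 := by gcongr
    _ = q a := by rw [hh]; field_simp

/-! ### The Poincaré inequality -/

/-- The operator norm of the differential is at most the Frobenius norm of the gradient. -/
lemma norm_fderiv_le_gradField (φ : E3 → E3) (x : E3) : ‖fderiv ℝ φ x‖ ≤ ‖gradField φ x‖ := by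
  refine ContinuousLinearMap.opNorm_le_bound _ (norm_nonneg _) fun y => ?_
  refine abs_le_of_sq_le_sq' ?_ (by positivity) |>.2
  have hy : y = ∑ j, y j • EuclideanSpace.single j (1 : ℝ) := by
    ext i; simp [Pi.single_apply]
  have hi : ∀ i, fderiv ℝ φ x y i = ∑ j, y j * gradField φ x (i, j) := fun i => by
    conv_lhs => rw [hy]
    simp [gradField]
  rw [mul_pow, EuclideanSpace.real_norm_sq_eq, EuclideanSpace.real_norm_sq_eq,
    EuclideanSpace.real_norm_sq_eq, Fintype.sum_prod_type, Finset.sum_mul]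
  refine Finset.sum_le_sum fun i _ => ?_
  rw [hi, mul_comm]
  exact Finset.sum_mul_sq_le_sq_mul_sq _ _ _

lemma fderiv_eq_zero_of_tsupport_subset {A : Set E3} {φ : E3 → E3}
    (h : tsupport φ ⊆ A) {x : E3} (hx : x ∉ A) :
    fderiv ℝ φ x = 0 :=
  image_eq_zero_of_notMem_tsupport fun h' => hx (h (tsupport_fderiv_subset ℝ h'))

/-- The Poincaré inequality for a smooth field with support in a bounded set. -/
lemma eLpNorm_le_gradField {A : Set E3} (hb : Bornology.IsBounded A) {φ : E3 → E3}
    (hφ : ContDiff ℝ ∞ φ) (hsupp : tsupport φ ⊆ A) :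
    eLpNorm φ 2 (volume.restrict A) ≤ eLpNormLESNormFDerivOfLeConst E3 (volume : Measure E3) A 2 2 *
      eLpNorm (gradField φ) 2 (volume.restrict A) := by
  have h1 := eLpNorm_le_eLpNorm_fderiv (volume : Measure E3) (p := 2)
    (hφ.of_le (by exact_mod_cast le_top)) ((subset_tsupport φ).trans hsupp) (by norm_num)
    (by rw [finrank_euclideanSpace_fin]; norm_num) hb
  have h2 : eLpNorm (fderiv ℝ φ) 2 volume ≤ eLpNorm (gradField φ) 2 (volume.restrict A) := by
    rw [← eLpNorm_restrict_eq_of_support_subset (f := fderiv ℝ φ) fun x hx =>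
      by_contra fun h' => hx (fderiv_eq_zero_of_tsupport_subset hsupp h')]
    exact eLpNorm_mono fun x => norm_fderiv_le_gradField φ x
  exact (eLpNorm_mono_measure _ Measure.restrict_le_self).trans (h1.trans (by gcongr; exact h2))

/-- The Poincaré inequality passes from the test fields to their closure. -/
lemma exists_poincare {A : Set E3} (hb : Bornology.IsBounded A) :
    ∃ C : ℝ, 0 < C ∧ ∀ (u : L2V A) (G : L2T A), IsW0Grad A u G → ‖u‖ ≤ C * ‖G‖ := by
  obtain ⟨K, hK⟩ : ∃ K : NNReal, K =
    eLpNormLESNormFDerivOfLeConst E3 (volume : Measure E3) A 2 2 := ⟨_, rfl⟩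
  refine ⟨K + 1, by positivity, fun u G h => ?_⟩
  have hcl : IsClosed {p : L2V A × L2T A | ‖p.1‖ ≤ (K + 1) * ‖p.2‖} :=
    isClosed_le continuous_fst.norm (continuous_const.mul continuous_snd.norm)
  have hsub : testGraph A ⊆ {p : L2V A × L2T A | ‖p.1‖ ≤ (K + 1) * ‖p.2‖} := by
    intro p hp
    unfold testGraph at hp
    rw [mem_ofPred_eq] at hp ⊢
    obtain ⟨φ, hφ, -, hsupp, hu, hG⟩ := hp
    have h3 : eLpNorm p.1 2 (volume.restrict A) ≤ K * eLpNorm p.2 2 (volume.restrict A) := by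
      rw [eLpNorm_congr_ae hu, eLpNorm_congr_ae hG, hK]
      exact eLpNorm_le_gradField hb hφ hsupp
    have h4 : ‖p.1‖ ≤ K * ‖p.2‖ := by
      rw [Lp.norm_def, Lp.norm_def, ← ENNReal.coe_toReal, ← ENNReal.toReal_mul]
      exact ENNReal.toReal_mono (ENNReal.mul_ne_top ENNReal.coe_ne_top (Lp.eLpNorm_ne_top _)) h3
    exact h4.trans (by gcongr; simp)
  unfold IsW0Grad at h
  have hu := closure_minimal hsub hcl h
  rw [mem_ofPred_eq] at hu
  exact hu

/-! ### The kinetic energy of the relative motion -/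

namespace SolidLiquidSystem

variable (S : SolidLiquidSystem)

lemma measurableSet_cavity : MeasurableSet S.cavity := S.cavity_domain.isOpen.measurableSet

lemma measurableSet_body : MeasurableSet S.body :=
  S.outer_domain.isOpen.measurableSet.diff isClosed_closure.measurableSet

lemma isBounded_body : Bornology.IsBounded S.body :=
  S.outer_domain.bounded.subset sdiff_subset

lemma volume_cavity_ne_top : volume S.cavity ≠ ⊤ :=
  S.cavity_domain.bounded.measure_lt_top.ne

lemma isFiniteMeasure_cavity : IsFiniteMeasure ((volume : Measure E3).restrict S.cavity) :=
  ⟨by simpa using S.cavity_domain.bounded.measure_lt_top⟩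

lemma exists_norm_le_cavity : ∃ C, ∀ x ∈ S.cavity, ‖x‖ ≤ C :=
  S.cavity_domain.bounded.exists_norm_le

lemma memLp_cross (a : E3) :
    MemLp (fun x => cross a x) 2 ((volume : Measure E3).restrict S.cavity) := by
  have := S.isFiniteMeasure_cavity
  obtain ⟨C, hC⟩ := S.exists_norm_le_cavity
  refine MemLp.of_bound (crossL a).continuous.aestronglyMeasurable (‖a‖ * C) ?_
  filter_upwards [ae_restrict_mem S.measurableSet_cavity] with x hx
  exact (norm_cross_le a x).trans (by gcongr; exact hC x hx)

/-- The velocity field `x ↦ a × x` of the rigid rotation with angular velocity `a`, as an element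
of `L²` of the cavity. -/
noncomputable def rotation : E3 →L[ℝ] L2V S.cavity :=
  LinearMap.toContinuousLinearMap
    { toFun := fun a => (S.memLp_cross a).toLp _
      map_add' := fun a b => by
        rw [← MemLp.toLp_add]
        congr 1
        ext1 x
        exact cross_add_left a b x
      map_smul' := fun r a => by
        rw [RingHom.id_apply, ← MemLp.toLp_const_smul]
        congr 1
        ext1 x
        exact cross_smul_left r a x }

lemma coeFn_rotation (a : E3) :
    S.rotation a =ᵐ[(volume : Measure E3).restrict S.cavity] fun x => cross a x :=
  (S.memLp_cross a).coeFn_toLp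

lemma integrable_cross (w : L2V S.cavity) : IntegrableOn (fun x => cross x (w x)) S.cavity := by
  have := S.isFiniteMeasure_cavity
  obtain ⟨C, hC⟩ := S.exists_norm_le_cavity
  have hw : Integrable w (volume.restrict S.cavity) := (Lp.memLp w).integrable one_le_two
  refine (hw.norm.const_mul C).mono' (crossL.aestronglyMeasurable_comp₂
    continuous_id.aestronglyMeasurable hw.aestronglyMeasurable) ?_
  filter_upwards [ae_restrict_mem S.measurableSet_cavity] with x hx
  exact (norm_cross_le _ _).trans (by gcongr; exact hC x hx)

/-- The moment `w ↦ ∫ x × w` is adjoint to `a ↦ a × x`. -/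
lemma inner_moment (a : E3) (w : L2V S.cavity) :
    inner ℝ a (S.moment w) = inner ℝ (S.rotation a) w := by
  rw [moment, ← integral_inner (S.integrable_cross w), L2.inner_def]
  refine integral_congr_ae ?_
  filter_upwards [S.coeFn_rotation a] with x hx
  rw [hx, inner_cross_cyclic]

lemma moment_eq_adjoint (w : L2V S.cavity) :
    S.moment w = ContinuousLinearMap.adjoint S.rotation w :=
  ext_inner_left ℝ fun a => by rw [inner_moment, ContinuousLinearMap.adjoint_inner_right]

/-- `w ↦ 𝐚` as a continuous linear map. -/
noncomputable def avecL : L2V S.cavity →L[ℝ] E3 :=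
  -(S.ρ • (actL S.inertia⁻¹ ∘L ContinuousLinearMap.adjoint S.rotation))

lemma avecL_apply (w : L2V S.cavity) : S.avecL w = S.avec w := by
  simp [avecL, avec, actL_apply, moment_eq_adjoint]

/-- Twice the kinetic energy of the rigid body rotating with angular velocity `a`. -/
noncomputable def bodyForm (a : E3) : ℝ :=
  ∫ x in S.body, S.bodyDensity x * ‖cross a x‖ ^ 2

lemma norm_rotation_sq (a : E3) : ‖S.rotation a‖ ^ 2 = ∫ x in S.cavity, ‖cross a x‖ ^ 2 := by
  rw [← real_inner_self_eq_norm_sq, L2.inner_def]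
  refine integral_congr_ae ?_
  filter_upwards [S.coeFn_rotation a] with x hx
  rw [hx, real_inner_self_eq_norm_sq]

lemma integrableOn_bodyDensity : IntegrableOn S.bodyDensity S.body := S.bodyDensity_integrable

lemma inertia_eq : S.inertia = Matrix.of (fun i j => ∫ x in S.body,
      S.bodyDensity x * (‖x‖ ^ 2 * (if i = j then 1 else 0) - x i * x j)) +
    S.ρ • Matrix.of (fun i j => ∫ x in S.cavity,
      (1 : ℝ) * (‖x‖ ^ 2 * (if i = j then 1 else 0) - x i * x j)) := by
  ext i j
  simp [inertia]

lemma bodyForm_eq (a : E3) : S.bodyForm a = inner ℝ a (act (Matrix.of (fun i j =>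
    ∫ x in S.body, S.bodyDensity x * (‖x‖ ^ 2 * (if i = j then 1 else 0) - x i * x j))) a) :=
  (inner_act_inertia S.measurableSet_body S.isBounded_body S.integrableOn_bodyDensity a).symm

lemma inner_act_inertia_self (a : E3) :
    inner ℝ a (act S.inertia a) = S.bodyForm a + S.ρ * ‖S.rotation a‖ ^ 2 := by
  have h1 : IntegrableOn (fun _ : E3 => (1 : ℝ)) S.cavity :=
    integrableOn_const S.volume_cavity_ne_top
  rw [inertia_eq, act_add, act_smul, inner_add_right, inner_smul_right, bodyForm_eq,
    inner_act_inertia S.measurableSet_cavity S.cavity_domain.bounded h1, norm_rotation_sq]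
  simp

lemma inertia_isSymm : S.inertia.IsSymm := by
  ext i j
  simp [inertia, eq_comm, mul_comm]

lemma exists_bodyForm_coercive : ∃ δ, 0 < δ ∧ ∀ a, δ * ‖a‖ ^ 2 ≤ S.bodyForm a := by
  refine exists_coercive ?_ (fun r a => ?_) fun a ha => ?_
  · simp only [funext S.bodyForm_eq, ← actL_apply]
    fun_prop
  · simp only [bodyForm, cross_smul_left, norm_smul, mul_pow, Real.norm_eq_abs, sq_abs,
      ← integral_const_mul]
    congr 1
    ext x
    ring
  · exact inertia_pos S.measurableSet_body S.isBounded_body S.integrableOn_bodyDensity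
      S.bodyDensity_nonneg S.bodyMass_pos ha

lemma bodyForm_nonneg (a : E3) : 0 ≤ S.bodyForm a := by
  obtain ⟨δ, hδ, h⟩ := S.exists_bodyForm_coercive
  exact le_trans (by positivity) (h a)

lemma inner_act_inertia_nonneg (a : E3) : 0 ≤ inner ℝ a (act S.inertia a) := by
  rw [inner_act_inertia_self]
  have := S.bodyForm_nonneg a
  have := S.ρ_pos
  positivity

lemma isUnit_det_inertia : IsUnit S.inertia.det := by
  rw [← Matrix.isUnit_iff_isUnit_det, ← Matrix.mulVec_injective_iff_isUnit]
  refine (injective_iff_map_eq_zero S.inertia.mulVecLin).2 fun b hb => ?_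
  obtain ⟨δ, hδ, h⟩ := S.exists_bodyForm_coercive
  have h1 := S.inner_act_inertia_self (WithLp.toLp 2 b)
  have h2 : act S.inertia (WithLp.toLp 2 b) = 0 := by
    simp only [Matrix.mulVecLin_apply] at hb
    simp [act, hb]
  rw [h2, inner_zero_right] at h1
  have h3 := h (WithLp.toLp 2 b)
  have h4 : 0 ≤ S.ρ * ‖S.rotation (WithLp.toLp 2 b)‖ ^ 2 := by
    have := S.ρ_pos
    positivity
  have h5 : ‖(WithLp.toLp 2 b : E3)‖ ^ 2 ≤ 0 := by
    by_contra! hpos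
    nlinarith [mul_pos hδ hpos]
  have h6 : (WithLp.toLp 2 b : E3) = 0 := by
    rw [← norm_eq_zero, ← sq_eq_zero_iff]
    exact le_antisymm h5 (sq_nonneg _)
  simpa using h6

lemma act_inertia_inv_act (b : E3) : act S.inertia⁻¹ (act S.inertia b) = b := by
  rw [act_act, Matrix.nonsing_inv_mul _ S.isUnit_det_inertia, act_one]

lemma act_inertia_avec (w : L2V S.cavity) :
    act S.inertia (S.avec w) = -(S.ρ • S.moment w) := by
  rw [avec, ← actL_apply, map_neg, map_smul, actL_apply, act_act,
    Matrix.mul_nonsing_inv _ S.isUnit_det_inertia, act_one]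

/-- Twice the kinetic energy of the motion relative to the rigid rotation that carries the total
angular momentum. -/
noncomputable def relEnergy (w : L2V S.cavity) : ℝ :=
  S.ρ * ‖w‖ ^ 2 - inner ℝ (S.avec w) (act S.inertia (S.avec w))

lemma energy_eq (w : L2V S.cavity) (b : E3) :
    S.energy w b = (S.relEnergy w + inner ℝ b (act S.inertia b)) / 2 := by
  rw [energy, relEnergy]
  ring

lemma continuous_relEnergy : Continuous S.relEnergy := by
  unfold relEnergy
  simp only [← avecL_apply, ← actL_apply]
  fun_prop

/-- The relative kinetic energy as a sum of squares: the body rotates with angular velocity `𝐚`,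
and the liquid moves with velocity `w` relative to it. -/
lemma relEnergy_eq (w : L2V S.cavity) : S.relEnergy w =
    S.ρ * ‖w + S.rotation (S.avec w)‖ ^ 2 + S.bodyForm (S.avec w) := by
  have h1 := S.inner_act_inertia_self (S.avec w)
  have h2 : inner ℝ (S.avec w) (act S.inertia (S.avec w)) =
      -(S.ρ * inner ℝ w (S.rotation (S.avec w))) := by
    rw [act_inertia_avec, inner_neg_right, inner_smul_right, inner_moment, real_inner_comm w]
  rw [relEnergy, norm_add_sq_real]
  linarith

lemma relEnergy_le (w : L2V S.cavity) : S.relEnergy w ≤ S.ρ * ‖w‖ ^ 2 := by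
  have := S.inner_act_inertia_nonneg (S.avec w)
  rw [relEnergy]
  linarith

lemma exists_norm_sq_le_relEnergy : ∃ K, 0 < K ∧ ∀ w, ‖w‖ ^ 2 ≤ K * S.relEnergy w := by
  obtain ⟨δ, hδ, h⟩ := S.exists_bodyForm_coercive
  have hρ := S.ρ_pos
  refine ⟨2 / S.ρ + 2 * ‖S.rotation‖ ^ 2 / δ, by positivity, fun w => ?_⟩
  set a := S.avec w with ha
  have h1 : ‖w‖ ≤ ‖w + S.rotation a‖ + ‖S.rotation‖ * ‖a‖ := by
    calc ‖w‖ = ‖(w + S.rotation a) - S.rotation a‖ := by rw [add_sub_cancel_right]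
      _ ≤ _ := (norm_sub_le _ _).trans (by gcongr; exact S.rotation.le_opNorm a)
  have h2 : ‖w‖ ^ 2 ≤ 2 * ‖w + S.rotation a‖ ^ 2 + 2 * ‖S.rotation‖ ^ 2 * ‖a‖ ^ 2 := by
    calc ‖w‖ ^ 2 ≤ (‖w + S.rotation a‖ + ‖S.rotation‖ * ‖a‖) ^ 2 := by gcongr
      _ ≤ _ := by linarith [sq_nonneg (‖w + S.rotation a‖ - ‖S.rotation‖ * ‖a‖)]
  have hE := S.relEnergy_eq w
  rw [← ha] at hE
  have hb := h a
  have hb0 := S.bodyForm_nonneg a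
  have h3 : ‖w + S.rotation a‖ ^ 2 ≤ S.relEnergy w / S.ρ := by
    rw [le_div_iff₀ hρ]
    linarith
  have h4 : ‖a‖ ^ 2 ≤ S.relEnergy w / δ := by
    rw [le_div_iff₀ hδ]
    linarith [mul_nonneg hρ.le (sq_nonneg ‖w + S.rotation a‖)]
  calc ‖w‖ ^ 2 ≤ 2 * (S.relEnergy w / S.ρ) + 2 * ‖S.rotation‖ ^ 2 * (S.relEnergy w / δ) := by
        refine h2.trans ?_
        gcongr
    _ = _ := by ring

lemma relEnergy_nonneg (w : L2V S.cavity) : 0 ≤ S.relEnergy w := by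
  obtain ⟨K, hK, h⟩ := S.exists_norm_sq_le_relEnergy
  exact nonneg_of_mul_nonneg_right ((sq_nonneg _).trans (h w)) hK

end SolidLiquidSystem

/-! ### Decay from integral inequalities -/

lemma intervalIntegrable_of_integrableOn_Ioi {E : Type*} [NormedAddCommGroup E] {f : ℝ → E}
    (hf : IntegrableOn f (Ioi 0)) {s t : ℝ} (hs : 0 ≤ s) (hst : s ≤ t) :
    IntervalIntegrable f volume s t :=
  (intervalIntegrable_iff_integrableOn_Ioc_of_le hst).2
    (hf.mono_set fun _ hx => hs.trans_lt hx.1)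

lemma intervalIntegrable_of_memLp_two {x : ℝ → ℝ} (hx : MemLp x 2 (volume.restrict (Ioi (0 : ℝ))))
    {s t : ℝ} (hs : 0 ≤ s) (hst : s ≤ t) : IntervalIntegrable x volume s t := by
  have hsub : Ioc s t ⊆ Ioi (0 : ℝ) := fun _ hx => hs.trans_lt hx.1
  rw [intervalIntegrable_iff_integrableOn_Ioc_of_le hst]
  have h := hx.mono_measure (Measure.restrict_mono hsub le_rfl)
  exact h.integrable one_le_two

lemma ae_restrict_Icc_of_Ioi {P : ℝ → Prop} (h : ∀ᵐ τ ∂(volume.restrict (Ioi (0 : ℝ))), P τ)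
    {s t : ℝ} (hs : 0 ≤ s) : ∀ᵐ τ ∂(volume.restrict (Icc s t)), P τ ∧ s < τ ∧ τ ≤ t := by
  have hsub : Ioc s t ⊆ Ioi (0 : ℝ) := fun _ hx => hs.trans_lt hx.1
  rw [← Measure.restrict_congr_set Ioc_ae_eq_Icc]
  filter_upwards [ae_restrict_of_ae_restrict_of_subset hsub h, ae_restrict_mem measurableSet_Ioc]
    with τ h1 h2 using ⟨h1, h2⟩

lemma tendsto_integral_unit_interval {g : ℝ → ℝ} (hg : IntegrableOn g (Ioi 0)) :
    Tendsto (fun t => ∫ s in (t - 1)..t, g s) atTop (𝓝 0) := by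
  have h1 := intervalIntegral_tendsto_integral_Ioi 0 hg tendsto_id
  have h2 := intervalIntegral_tendsto_integral_Ioi 0 hg
    (tendsto_atTop_add_const_right atTop (-1 : ℝ) tendsto_id)
  have h3 := h1.sub h2
  rw [sub_self] at h3
  refine h3.congr' ?_
  filter_upwards [eventually_ge_atTop 1] with t ht
  rw [intervalIntegral.integral_interval_sub_left]
  · simp [sub_eq_add_neg]
  · exact intervalIntegrable_of_integrableOn_Ioi hg le_rfl (by simp; linarith)
  · exact intervalIntegrable_of_integrableOn_Ioi hg le_rfl (by simp; linarith)

/-- The Cauchy–Schwarz inequality on an interval of length one. -/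
lemma sq_integral_unit_le {x : ℝ → ℝ} {t : ℝ} (hx : IntervalIntegrable x volume (t - 1) t)
    (hx2 : IntervalIntegrable (fun s => x s ^ 2) volume (t - 1) t) :
    (∫ s in (t - 1)..t, x s) ^ 2 ≤ ∫ s in (t - 1)..t, x s ^ 2 := by
  set m := ∫ s in (t - 1)..t, x s with hm
  have h0 : 0 ≤ ∫ s in (t - 1)..t, (x s - m) ^ 2 :=
    intervalIntegral.integral_nonneg (by linarith) fun s _ => sq_nonneg _
  have h1 : ∫ s in (t - 1)..t, (x s - m) ^ 2 = (∫ s in (t - 1)..t, x s ^ 2) - 2 * m * m + m ^ 2 := by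
    have : ∀ s, (x s - m) ^ 2 = x s ^ 2 - 2 * m * x s + m ^ 2 := fun s => by ring
    simp only [this]
    rw [intervalIntegral.integral_add (hx2.sub (hx.const_mul _)) intervalIntegrable_const,
      intervalIntegral.integral_sub hx2 (hx.const_mul _), intervalIntegral.integral_const_mul,
      intervalIntegral.integral_const, ← hm]
    simp
  linarith [h1 ▸ h0]

/-- If `x` is square integrable and the increase of `F` over `(s, t)` is controlled by `∫ x`, then
averaging over `s ∈ (t - 1, t)` shows that `F` decays. -/
lemma tendsto_zero_of_ae_le {x F : ℝ → ℝ} {r B : ℝ}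
    (hx : MemLp x 2 (volume.restrict (Ioi (0 : ℝ)))) (hx0 : ∀ s, 0 ≤ x s) (hB : 0 ≤ B)
    (hF : ∀ t, 0 ≤ F t)
    (h : ∀ᵐ s ∂(volume.restrict (Ioi (0 : ℝ))), ∀ t, s ≤ t →
      F t ≤ r * x s ^ 2 + B * ∫ τ in s..t, x τ) :
    Tendsto F atTop (𝓝 0) := by
  have hx2 : IntegrableOn (fun s => x s ^ 2) (Ioi 0) := hx.integrable_sq
  have hP := tendsto_integral_unit_interval hx2
  have hlim : Tendsto (fun t => r * (∫ s in (t - 1)..t, x s ^ 2) +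
      B * √(∫ s in (t - 1)..t, x s ^ 2)) atTop (𝓝 0) := by
    have := (hP.const_mul r).add ((hP.sqrt).const_mul B)
    simpa using this
  refine squeeze_zero' (Eventually.of_forall hF) ?_ hlim
  filter_upwards [eventually_ge_atTop 1] with t ht
  have ht0 : 0 ≤ t - 1 := by linarith
  have htt : t - 1 ≤ t := by linarith
  have hi2 := intervalIntegrable_of_integrableOn_Ioi hx2 ht0 htt
  have hi := intervalIntegrable_of_memLp_two hx ht0 htt
  have hcs : ∫ s in (t - 1)..t, x s ≤ √(∫ s in (t - 1)..t, x s ^ 2) :=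
    Real.le_sqrt_of_sq_le (sq_integral_unit_le hi hi2)
  have hae : ∀ᵐ s ∂(volume.restrict (Icc (t - 1) t)),
      F t ≤ r * x s ^ 2 + B * ∫ τ in (t - 1)..t, x τ := by
    filter_upwards [ae_restrict_Icc_of_Ioi h ht0] with s ⟨hs, hs1, hs2⟩
    refine (hs t hs2).trans ?_
    have := intervalIntegral.integral_mono_interval hs1.le hs2 le_rfl
      (Eventually.of_forall fun s => hx0 s) hi
    gcongr
  have hmono := intervalIntegral.integral_mono_ae_restrict htt intervalIntegrable_const
    ((hi2.const_mul r).add intervalIntegrable_const) hae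
  rw [intervalIntegral.integral_add (hi2.const_mul r) intervalIntegrable_const,
    intervalIntegral.integral_const_mul] at hmono
  simp only [intervalIntegral.integral_const, sub_sub_cancel, one_smul] at hmono
  exact hmono.trans (by gcongr)

/-- A Grönwall inequality for functions that satisfy the integrated differential inequality only
from almost every initial time. -/
lemma le_exp_of_ae_le {f : ℝ → ℝ} {k : ℝ} (hk : 0 ≤ k) (hf : IntegrableOn f (Ioi 0))
    (h0 : ∀ t, 0 ≤ t → f t + k * ∫ τ in (0 : ℝ)..t, f τ ≤ f 0)
    (h : ∀ᵐ s ∂(volume.restrict (Ioi (0 : ℝ))), ∀ t, s ≤ t → f t + k * ∫ τ in s..t, f τ ≤ f s)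
    {t : ℝ} (ht : 0 ≤ t) : f t ≤ f 0 * Real.exp (-(k * t)) := by
  have hft := intervalIntegrable_of_integrableOn_Ioi hf le_rfl ht
  -- `g` is a continuous minorant of `f` on `[0, t]`, with `g 0 ≤ f 0`, which inherits the integral
  -- inequality for every initial time.
  set g : ℝ → ℝ := fun s => f t + k * ∫ τ in s..t, f τ with hg
  have hgc : ContinuousOn g (Icc 0 t) := by
    have h1 := intervalIntegral.continuousOn_primitive_interval_left
      ((intervalIntegrable_iff' (by simp)).1 hft)
    rw [uIcc_of_le ht] at h1
    exact continuousOn_const.add (continuousOn_const.mul h1)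
  have hgi : ∀ s ∈ Icc 0 t, IntervalIntegrable g volume s t := fun s hs =>
    (hgc.mono (Icc_subset_Icc_left hs.1)).intervalIntegrable_of_Icc hs.2
  set H : ℝ → ℝ := fun s => f t + k * ∫ τ in s..t, g τ with hH
  have hHg : ∀ s ∈ Icc 0 t, H s ≤ g s := fun s hs => by
    have hae : ∀ᵐ τ ∂(volume.restrict (Icc s t)), g τ ≤ f τ := by
      filter_upwards [ae_restrict_Icc_of_Ioi h hs.1] with τ hτ using hτ.1 t hτ.2.2
    have := intervalIntegral.integral_mono_ae_restrict hs.2 (hgi s hs)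
      (intervalIntegrable_of_integrableOn_Ioi hf hs.1 hs.2) hae
    simp only [hH, hg]
    gcongr
  have hHc : ContinuousOn H (Icc 0 t) := by
    have h1 := intervalIntegral.continuousOn_primitive_interval_left
      ((intervalIntegrable_iff' (by simp)).1 (hgi 0 ⟨le_rfl, ht⟩))
    rw [uIcc_of_le ht] at h1
    exact continuousOn_const.add (continuousOn_const.mul h1)
  have hHd : ∀ s ∈ Ioo 0 t, HasDerivAt H (k * -g s) s := fun s hs => by
    have hca : ContinuousAt g s := hgc.continuousAt (Icc_mem_nhds hs.1 hs.2)
    have hms : StronglyMeasurableAtFilter g (𝓝 s) :=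
      (hgc.mono Ioo_subset_Icc_self).stronglyMeasurableAtFilter isOpen_Ioo s hs
    exact ((intervalIntegral.integral_hasDerivAt_left (hgi s ⟨hs.1.le, hs.2.le⟩) hms
      hca).const_mul k).const_add (f t)
  have hanti : AntitoneOn (fun s => H s * Real.exp (k * s)) (Icc 0 t) := by
    have hd : ∀ s ∈ Ioo 0 t, HasDerivAt (fun s => H s * Real.exp (k * s))
        (k * -g s * Real.exp (k * s) + H s * (Real.exp (k * s) * (k * 1))) s := fun s hs =>
      (hHd s hs).mul (((hasDerivAt_id s).const_mul k).exp)
    refine antitoneOn_of_deriv_nonpos (convex_Icc 0 t) (hHc.mul (by fun_prop)) ?_ ?_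
    · rw [interior_Icc]
      exact fun s hs => (hd s hs).differentiableAt.differentiableWithinAt
    · rw [interior_Icc]
      intro s hs
      rw [(hd s hs).deriv]
      have h1 := hHg s ⟨hs.1.le, hs.2.le⟩
      have h2 : 0 ≤ k * Real.exp (k * s) * (g s - H s) :=
        mul_nonneg (by positivity) (by linarith)
      linarith
  have h1 := hanti ⟨le_rfl, ht⟩ ⟨ht, le_rfl⟩ ht
  have h2 : H t = f t := by simp [hH]
  have h3 := (hHg 0 ⟨le_rfl, ht⟩).trans (h0 t ht)
  simp only [h2, mul_zero, Real.exp_zero, mul_one] at h1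
  rw [Real.exp_neg, ← div_eq_mul_inv, le_div_iff₀ (Real.exp_pos _)]
  exact h1.trans h3

/-! ### The total angular momentum along a weak solution -/

namespace SolidLiquidSystem

variable {S : SolidLiquidSystem} {μ : ℝ} {v : ℝ → L2V S.cavity} {ωinf : ℝ → E3}
  {G : ℝ → L2T S.cavity}

namespace IsWeakSolutionWithGrad

lemma continuousOn_avec (h : S.IsWeakSolutionWithGrad μ v ωinf G) :
    ContinuousOn (fun t => S.avec (v t)) (Ici 0) := by
  have h1 : ContinuousOn (fun t => (S.avec (v t)).ofLp) (Ici 0) :=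
    continuousOn_pi.2 fun i => by
      simpa [← avecL_apply] using h.weak_cont (EuclideanSpace.proj i ∘L S.avecL)
  exact (PiLp.continuous_toLp 2 _).comp_continuousOn h1

lemma continuousOn_angular (h : S.IsWeakSolutionWithGrad μ v ωinf G) :
    ContinuousOn (fun t => act S.inertia (ωinf t)) (Ici 0) :=
  (actL S.inertia).continuous.comp_continuousOn h.omega_cont

/-- The integrated balance of angular momentum can be differentiated at every positive time, since
`𝐚` depends continuously on time: it is a bounded linear image of the weakly continuous `v`. -/
lemma hasDerivAt_angular (h : S.IsWeakSolutionWithGrad μ v ωinf G) {t : ℝ} (ht : 0 < t) :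
    HasDerivAt (fun t => act S.inertia (ωinf t))
      (-cross (ωinf t + S.avec (v t)) (act S.inertia (ωinf t))) t := by
  have hc : ContinuousOn (fun t => cross (ωinf t + S.avec (v t)) (act S.inertia (ωinf t))) (Ici 0) :=
    (crossL.continuous.comp_continuousOn (h.omega_cont.add h.continuousOn_avec)).clm_apply
      h.continuousOn_angular
  have hi : IntervalIntegrable (fun t => cross (ωinf t + S.avec (v t)) (act S.inertia (ωinf t)))
      volume 0 t := (hc.mono Icc_subset_Ici_self).intervalIntegrable_of_Icc ht.le
  have hd := (intervalIntegral.integral_hasDerivAt_right hi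
    ((hc.mono Ioi_subset_Ici_self).stronglyMeasurableAtFilter isOpen_Ioi t ht)
    (hc.continuousAt (Ici_mem_nhds ht))).const_sub (act S.inertia (ωinf 0))
  refine hd.congr_of_eventuallyEq ?_
  filter_upwards [Ioi_mem_nhds ht] with s hs using h.angular s hs

/-- The magnitude of the total angular momentum is conserved. -/
lemma norm_angular (h : S.IsWeakSolutionWithGrad μ v ωinf G) {t : ℝ} (ht : 0 ≤ t) :
    ‖act S.inertia (ωinf t)‖ = ‖act S.inertia (ωinf 0)‖ := by
  have h1 := intervalIntegral.integral_eq_sub_of_hasDerivAt_of_le (f' := fun _ => (0 : ℝ)) ht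
    ((h.continuousOn_angular.mono Icc_subset_Ici_self).norm.pow 2)
    (fun s hs => by
      have := (h.hasDerivAt_angular hs.1).norm_sq
      rwa [inner_neg_right, inner_cross_self, neg_zero, mul_zero] at this)
    intervalIntegrable_const
  rw [intervalIntegral.integral_zero] at h1
  exact (sq_eq_sq₀ (norm_nonneg _) (norm_nonneg _)).1 (sub_eq_zero.1 h1.symm)

lemma norm_omega_le (h : S.IsWeakSolutionWithGrad μ v ωinf G) {t : ℝ} (ht : 0 ≤ t) :
    ‖ωinf t‖ ≤ ‖actL S.inertia⁻¹‖ * ‖act S.inertia (ωinf 0)‖ := by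
  have h1 := (actL S.inertia⁻¹).le_opNorm (act S.inertia (ωinf t))
  rwa [actL_apply, S.act_inertia_inv_act, h.norm_angular ht] at h1

/-- The energy `ω_∞ · 𝐈 · ω_∞` changes only through the relative motion of the liquid. -/
lemma hasDerivAt_rigidEnergy (h : S.IsWeakSolutionWithGrad μ v ωinf G) {t : ℝ} (ht : 0 < t) :
    HasDerivAt (fun t => inner ℝ (ωinf t) (act S.inertia (ωinf t)))
      (-2 * inner ℝ (ωinf t) (cross (S.avec (v t)) (act S.inertia (ωinf t)))) t := by
  have hω : HasDerivAt ωinf (deriv ωinf t) t :=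
    ((h.omega_C1.differentiableOn one_ne_zero).differentiableAt (Ioi_mem_nhds ht)).hasDerivAt
  have hM := h.hasDerivAt_angular ht
  have hM' : act S.inertia (deriv ωinf t) = -cross (ωinf t + S.avec (v t)) (act S.inertia (ωinf t)) :=
    ((actL S.inertia).hasFDerivAt.comp_hasDerivAt t hω).unique hM
  refine (hω.inner ℝ hM).congr_deriv ?_
  rw [inner_act_comm S.inertia_isSymm (deriv ωinf t), hM', cross_add_left, inner_neg_right,
    inner_add_right, inner_self_cross]
  ring

lemma intervalIntegrable_norm (h : S.IsWeakSolutionWithGrad μ v ωinf G) {s t : ℝ} (hs : 0 ≤ s)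
    (hst : s ≤ t) : IntervalIntegrable (fun τ => ‖v τ‖) volume s t :=
  intervalIntegrable_of_memLp_two h.memLp_two.norm hs hst

/-- A bound for the loss of `ω_∞ · 𝐈 · ω_∞`. -/
lemma rigidEnergy_le (h : S.IsWeakSolutionWithGrad μ v ωinf G) {s t : ℝ} (hs : 0 ≤ s)
    (hst : s ≤ t) :
    inner ℝ (ωinf s) (act S.inertia (ωinf s)) ≤ inner ℝ (ωinf t) (act S.inertia (ωinf t)) +
      2 * ‖actL S.inertia⁻¹‖ * ‖act S.inertia (ωinf 0)‖ ^ 2 * ‖S.avecL‖ * ∫ τ in s..t, ‖v τ‖ := by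
  have hsub : Icc s t ⊆ Ici 0 := fun _ hx => hs.trans hx.1
  have hc : ContinuousOn (fun t => -2 * inner ℝ (ωinf t)
      (cross (S.avec (v t)) (act S.inertia (ωinf t)))) (Icc s t) := by
    refine ContinuousOn.mono (continuousOn_const.mul (h.omega_cont.inner ?_)) hsub
    exact (crossL.continuous.comp_continuousOn h.continuousOn_avec).clm_apply
      h.continuousOn_angular
  have hi := hc.intervalIntegrable_of_Icc (μ := volume) hst
  have h1 := intervalIntegral.integral_eq_sub_of_hasDerivAt_of_le hst
    ((h.omega_cont.inner h.continuousOn_angular).mono hsub)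
    (fun τ hτ => h.hasDerivAt_rigidEnergy (hs.trans_lt hτ.1)) hi
  have h2 : ∫ τ in s..t,
      -(2 * ‖actL S.inertia⁻¹‖ * ‖act S.inertia (ωinf 0)‖ ^ 2 * ‖S.avecL‖ * ‖v τ‖) ≤
      ∫ τ in s..t, -2 * inner ℝ (ωinf τ) (cross (S.avec (v τ)) (act S.inertia (ωinf τ))) := by
    refine intervalIntegral.integral_mono_on hst
      ((h.intervalIntegrable_norm hs hst).const_mul _).neg hi fun τ hτ => ?_
    have hτ0 : 0 ≤ τ := hs.trans hτ.1
    have h3 : inner ℝ (ωinf τ) (cross (S.avec (v τ)) (act S.inertia (ωinf τ))) ≤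
        ‖actL S.inertia⁻¹‖ * ‖act S.inertia (ωinf 0)‖ *
          (‖S.avecL‖ * ‖v τ‖ * ‖act S.inertia (ωinf 0)‖) := by
      refine (real_inner_le_norm _ _).trans ?_
      gcongr
      · exact h.norm_omega_le hτ0
      · refine (norm_cross_le _ _).trans ?_
        rw [h.norm_angular hτ0, ← avecL_apply]
        gcongr
        exact S.avecL.le_opNorm _
    linarith
  rw [intervalIntegral.integral_neg, intervalIntegral.integral_const_mul, h1] at h2
  linarith

/-- If `𝐈` is isotropic, then `ω_∞ · 𝐈 · ω_∞` is conserved. -/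
lemma rigidEnergy_eq_of_isotropic (h : S.IsWeakSolutionWithGrad μ v ωinf G) {l : ℝ} (hl : 0 < l)
    (hI : S.inertia = l • (1 : Matrix (Fin 3) (Fin 3) ℝ)) {t : ℝ} (ht : 0 ≤ t) :
    inner ℝ (ωinf t) (act S.inertia (ωinf t)) = inner ℝ (ωinf 0) (act S.inertia (ωinf 0)) := by
  have h1 := h.norm_angular ht
  rw [hI, act_smul, act_smul, act_one, act_one, norm_smul, norm_smul] at h1
  have h2 := mul_left_cancel₀ (norm_ne_zero_iff.2 hl.ne') h1
  rw [hI, act_smul, act_smul, act_one, act_one, inner_smul_right, inner_smul_right,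
    real_inner_self_eq_norm_sq, real_inner_self_eq_norm_sq, h2]

/-! ### Decay of the relative motion -/

lemma integrableOn_relEnergy (h : S.IsWeakSolutionWithGrad μ v ωinf G) :
    IntegrableOn (fun t => S.relEnergy (v t)) (Ioi 0) := by
  have h1 : IntegrableOn (fun t => S.ρ * ‖v t‖ ^ 2) (Ioi 0) :=
    Integrable.const_mul h.memLp_two.norm.integrable_sq _
  refine Integrable.mono' h1
    (S.continuous_relEnergy.comp_aestronglyMeasurable h.memLp_two.aestronglyMeasurable) ?_
  refine Eventually.of_forall fun t => ?_
  rw [Real.norm_of_nonneg (S.relEnergy_nonneg _)]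
  exact S.relEnergy_le _

/-- The dissipation is discarded: the growth of the relative kinetic energy is at most the loss of
`ω_∞ · 𝐈 · ω_∞`, hence at most a multiple of `∫ ‖v‖`. -/
lemma tendsto_norm (h : S.IsWeakSolutionWithGrad μ v ωinf G) (hμ : 0 < μ) :
    Tendsto (fun t => ‖v t‖) atTop (𝓝 0) := by
  have hE : Tendsto (fun t => S.relEnergy (v t)) atTop (𝓝 0) := by
    refine tendsto_zero_of_ae_le (r := S.ρ)
      (B := 2 * ‖actL S.inertia⁻¹‖ * ‖act S.inertia (ωinf 0)‖ ^ 2 * ‖S.avecL‖) h.memLp_two.norm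
      (fun s => norm_nonneg _) (by positivity) (fun t => S.relEnergy_nonneg _) ?_
    filter_upwards [h.energy_ae, ae_restrict_mem measurableSet_Ioi] with s hs hs0 t hst
    have h1 := hs t hst
    have h2 := h.rigidEnergy_le (le_of_lt hs0) hst
    have h3 := S.relEnergy_le (v s)
    have h4 : 0 ≤ μ * ∫ τ in s..t, ‖G τ‖ ^ 2 :=
      mul_nonneg hμ.le (intervalIntegral.integral_nonneg hst fun _ _ => sq_nonneg _)
    rw [energy_eq, energy_eq] at h1
    linarith
  obtain ⟨K, hK, hKE⟩ := S.exists_norm_sq_le_relEnergy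
  have hlim : Tendsto (fun t => √(K * S.relEnergy (v t))) atTop (𝓝 0) := by
    simpa using (hE.const_mul K).sqrt
  exact squeeze_zero (fun t => norm_nonneg _) (fun t => Real.le_sqrt_of_sq_le (hKE _)) hlim

/-- By the Poincaré inequality, the dissipation dominates the relative kinetic energy. -/
lemma integral_relEnergy_le (h : S.IsWeakSolutionWithGrad μ v ωinf G) {C : ℝ}
    (hP : ∀ (u : L2V S.cavity) (H : L2T S.cavity), IsW0Grad S.cavity u H → ‖u‖ ≤ C * ‖H‖)
    {s t : ℝ} (hs : 0 ≤ s) (hst : s ≤ t) :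
    ∫ τ in s..t, S.relEnergy (v τ) ≤ S.ρ * C ^ 2 * ∫ τ in s..t, ‖G τ‖ ^ 2 := by
  have hi : IntegrableOn (fun τ => ‖G τ‖ ^ 2) (Ioi 0) := h.memLp_two_grad.norm.integrable_sq
  rw [← intervalIntegral.integral_const_mul]
  refine intervalIntegral.integral_mono_ae_restrict hst
    (intervalIntegrable_of_integrableOn_Ioi h.integrableOn_relEnergy hs hst)
    ((intervalIntegrable_of_integrableOn_Ioi hi hs hst).const_mul _) ?_
  filter_upwards [ae_restrict_Icc_of_Ioi h.grad hs] with τ hτ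
  have h1 := hP _ _ hτ.1.2
  calc S.relEnergy (v τ) ≤ S.ρ * ‖v τ‖ ^ 2 := S.relEnergy_le _
    _ ≤ S.ρ * (C * ‖G τ‖) ^ 2 := by
      have := S.ρ_pos
      gcongr
    _ = S.ρ * C ^ 2 * ‖G τ‖ ^ 2 := by ring

/-- In the isotropic case the relative kinetic energy itself satisfies the energy inequality. -/
lemma relEnergy_le_exp (h : S.IsWeakSolutionWithGrad μ v ωinf G) (hμ : 0 < μ) {l : ℝ} (hl : 0 < l)
    (hI : S.inertia = l • (1 : Matrix (Fin 3) (Fin 3) ℝ)) {C : ℝ} (hC : 0 < C)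
    (hP : ∀ (u : L2V S.cavity) (H : L2T S.cavity), IsW0Grad S.cavity u H → ‖u‖ ≤ C * ‖H‖)
    {t : ℝ} (ht : 0 ≤ t) :
    S.relEnergy (v t) ≤ S.relEnergy (v 0) * Real.exp (-(2 * μ / (S.ρ * C ^ 2) * t)) := by
  have hρ := S.ρ_pos
  have key : ∀ s t, 0 ≤ s → s ≤ t →
      S.energy (v t) (ωinf t) + μ * (∫ τ in s..t, ‖G τ‖ ^ 2) ≤ S.energy (v s) (ωinf s) →
      S.relEnergy (v t) + 2 * μ / (S.ρ * C ^ 2) * (∫ τ in s..t, S.relEnergy (v τ)) ≤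
        S.relEnergy (v s) := by
    intro s t hs hst hE
    rw [energy_eq, energy_eq, h.rigidEnergy_eq_of_isotropic hl hI hs,
      h.rigidEnergy_eq_of_isotropic hl hI (hs.trans hst)] at hE
    have h1 : 2 * μ / (S.ρ * C ^ 2) * (∫ τ in s..t, S.relEnergy (v τ)) ≤
        2 * μ * ∫ τ in s..t, ‖G τ‖ ^ 2 := by
      calc _ ≤ 2 * μ / (S.ρ * C ^ 2) * (S.ρ * C ^ 2 * ∫ τ in s..t, ‖G τ‖ ^ 2) := by
            gcongr
            exact h.integral_relEnergy_le hP hs hst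
        _ = _ := by field_simp
    linarith
  refine le_exp_of_ae_le (f := fun t => S.relEnergy (v t)) (by positivity)
    h.integrableOn_relEnergy (fun t ht => key 0 t le_rfl ht (h.energy_zero t ht)) ?_ ht
  filter_upwards [h.energy_ae, ae_restrict_mem measurableSet_Ioi] with s hs hs0 t hst
  exact key s t (le_of_lt hs0) hst (hs t hst)

end IsWeakSolutionWithGrad

end SolidLiquidSystem

end SolidLiquid

theorem proposition1 (S : SolidLiquid.SolidLiquidSystem) :
    (∀ μ : ℝ, 0 < μ →
      ∀ (v : ℝ → SolidLiquid.L2V S.cavity) (ωinf : ℝ → SolidLiquid.E3), S.IsWeakSolution μ v ωinf →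
        Tendsto (fun t => ‖v t‖) atTop (𝓝 0)) ∧
    ((∃ l : ℝ, 0 < l ∧ S.inertia = l • (1 : Matrix (Fin 3) (Fin 3) ℝ)) →
      ∃ c₁ c₂ : ℝ, 0 < c₁ ∧ 0 < c₂ ∧ ∀ μ : ℝ, 0 < μ →
        ∀ (v : ℝ → SolidLiquid.L2V S.cavity) (ωinf : ℝ → SolidLiquid.E3), S.IsWeakSolution μ v ωinf →
          ∀ t : ℝ, 0 < t → ‖v t‖ ≤ c₁ * ‖v 0‖ * Real.exp (-(c₂ * μ * t))) := by
  refine ⟨fun μ hμ v ωinf ⟨G, h⟩ => h.tendsto_norm hμ, fun ⟨l, hl, hI⟩ => ?_⟩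
  obtain ⟨C, hC, hP⟩ := SolidLiquid.exists_poincare S.cavity_domain.bounded
  obtain ⟨K, hK, hKE⟩ := S.exists_norm_sq_le_relEnergy
  have hρ := S.ρ_pos
  -- The rate for `‖v‖` is half the rate for the relative kinetic energy, which is quadratic.
  refine ⟨√(K * S.ρ), 1 / (S.ρ * C ^ 2), by positivity, by positivity,
    fun μ hμ v ωinf ⟨G, h⟩ t ht => ?_⟩
  have h1 := h.relEnergy_le_exp hμ hl hI hC hP ht.le
  refine abs_le_of_sq_le_sq' ?_ (by positivity) |>.2
  have hexp : Real.exp (-(2 * μ / (S.ρ * C ^ 2) * t)) =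
      Real.exp (-(1 / (S.ρ * C ^ 2) * μ * t)) ^ 2 := by
    rw [← Real.exp_nat_mul]
    congr 1
    push_cast
    ring
  calc ‖v t‖ ^ 2 ≤ K * S.relEnergy (v t) := hKE _
    _ ≤ K * (S.ρ * ‖v 0‖ ^ 2 * Real.exp (-(2 * μ / (S.ρ * C ^ 2) * t))) := by
      gcongr
      exact h1.trans (by gcongr; exact S.relEnergy_le _)
    _ = _ := by
      rw [mul_pow, mul_pow, Real.sq_sqrt (by positivity), hexp]
      ring
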